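/- Let $n\ge 1$, let $\mu,\nu$ be Borel probability measures on $\mathbb R^n$ with $$\int_{\mathbb R^n}|x|^2\,d\mu(x)+\int_{\mathbb R^n}|y|^2\,d\nu(y)<\infty,$$ and let $\psi:\mathbb R^n\to(-\infty,+\infty]$ be a proper (not identically $+\infty$) lower semicontinuous convex function. Put $$\partial\psi(x)=\{z\in\mathbb R^n:\ \psi(y)\ge\psi(x)+z\cdot(y-x)\ \text{ for all } y\in\mathbb R^n\},\qquad \partial\psi(A)=\bigcup_{x\in A}\partial\psi(x),$$ $$\mathrm{Graph}\,\partial\psi=\{(x,z)\in\mathbb R^n\times\mathbb R^n:\ z\in\partial\psi(x)\},\qquad \psi^*(z)=\sup_{x\in\mathbb R^n}\big(x\cdot z-\psi(x)\big),$$ and define $\partial\psi^*$ in the same way from $\psi^*$. Suppose that $$\mu(A)\le\nu(\partial\psi(A))\quad\text{and}\quad \nu(A)\le\mu(\partial\psi^*(A))\qquad\text{for all Borel sets } A\subset\mathbb R^n$$ (the sets on the right are measurable for the completions of $\nu$ and $\mu$). Let $\Pi(\mu,\nu)$ be the set of probability measures on $\mathbb R^n\times\mathbb R^n$ with marginals $\mu$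 and $\nu$. Then there is a plan $\pi\in\Pi(\mu,\nu)$ that minimizes $\int|x-y|^2\,d\pi'(x,y)$ over all $\pi'\in\Pi(\mu,\nu)$ and satisfies $\mathrm{supp}(\pi)\subset\mathrm{Graph}\,\partial\psi$. Moreover, the pair $(\psi,\psi^*)$ is a minimizer of the dual problem $$\inf\Big\{\int f\,d\mu+\int g\,d\nu\ :\ x\cdot y\le f(x)+g(y)\quad\text{for all }(x,y)\in\mathbb R^n\times\mathbb R^n\Big\},$$ where $f,g:\mathbb R^n\to(-\infty,+\infty]$ range over the functions that are measurable for the completions of $\mu$ and $\nu$ respectively and whose negative parts satisfy $\int f^-\,d\mu<\infty$ and $\int g^-\,d\nu<\infty$, so that both integrals are defined in $(-\infty,+\infty]$; in particular $(\psi,\psi^*)$ is such a pair. -/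

import Mathlib

open MeasureTheory

noncomputable section

namespace ConvexTransport

/-- The space `ℝⁿ` with its Euclidean norm and inner product. -/
abbrev Rn (n : ℕ) : Type := EuclideanSpace ℝ (Fin n)

/-- A proper lower semicontinuous convex function `ψ : ℝⁿ → (-∞, +∞]`:
it never takes the value `-∞`, it is not identically `+∞`, it is lower semicontinuous,
and its epigraph is convex. -/
structure IsProperLscConvex {n : ℕ} (ψ : Rn n → EReal) : Prop where
  ne_bot : ∀ x, ψ x ≠ ⊥
  exists_ne_top : ∃ x, ψ x ≠ ⊤
  lsc : LowerSemicontinuous ψ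
  convex_epigraph : Convex ℝ {p : Rn n × ℝ | ψ p.1 ≤ (p.2 : EReal)}

/-- The subdifferential
`∂ψ(x) = {z | ψ(y) ≥ ψ(x) + z · (y - x) for all y}`. -/
def subdiff {n : ℕ} (ψ : Rn n → EReal) (x : Rn n) : Set (Rn n) :=
  {z | ∀ y : Rn n, ψ x + ((inner ℝ z (y - x) : ℝ) : EReal) ≤ ψ y}

/-- The image `∂ψ(A) = ⋃_{x ∈ A} ∂ψ(x)`. -/
def subdiffImage {n : ℕ} (ψ : Rn n → EReal) (A : Set (Rn n)) : Set (Rn n) :=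
  ⋃ x ∈ A, subdiff ψ x

/-- `Graph ∂ψ = {(x, z) | z ∈ ∂ψ(x)}`. -/
def subdiffGraph {n : ℕ} (ψ : Rn n → EReal) : Set (Rn n × Rn n) :=
  {p | p.2 ∈ subdiff ψ p.1}

/-- The Legendre transform `ψ*(z) = sup_x (x · z - ψ(x))`. -/
def legendre {n : ℕ} (ψ : Rn n → EReal) (z : Rn n) : EReal :=
  ⨆ x : Rn n, (((inner ℝ x z : ℝ) : EReal) - ψ x)

/-- The set `Π(μ, ν)` of transport plans: probability measures on `ℝⁿ × ℝⁿ` with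
marginals `μ` and `ν`. -/
def transportPlans {n : ℕ} (μ ν : Measure (Rn n)) : Set (Measure (Rn n × Rn n)) :=
  {π | IsProbabilityMeasure π ∧ π.fst = μ ∧ π.snd = ν}

/-- The quadratic transport cost `∫ |x - y|² dπ(x, y)`, with values in `[0, +∞]`. -/
def quadCost {n : ℕ} (π : Measure (Rn n × Rn n)) : ENNReal :=
  ∫⁻ p, ‖p.1 - p.2‖ₑ ^ 2 ∂π

/-- `π` is an optimal transport plan between `μ` and `ν` for the quadratic cost. -/
def IsOptimalPlan {n : ℕ} (μ ν : Measure (Rn n)) (π : Measure (Rn n × Rn n)) : Prop :=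
  π ∈ transportPlans μ ν ∧ ∀ π' ∈ transportPlans μ ν, quadCost π ≤ quadCost π'

/-- The integral of the negative part of `f`. -/
def negIntegral {n : ℕ} (μ : Measure (Rn n)) (f : Rn n → EReal) : ENNReal :=
  ∫⁻ x, (-f x).toENNReal ∂μ

/-- The integral `∫ f dμ = ∫ f⁺ dμ - ∫ f⁻ dμ` of an extended-real valued function; it is only
used for functions with `∫ f⁻ dμ < ∞`, and takes values in `(-∞, +∞]` on them. -/
def extIntegral {n : ℕ} (μ : Measure (Rn n)) (f : Rn n → EReal) : EReal :=
  ((∫⁻ x, (f x).toENNReal ∂μ : ENNReal) : EReal) - ((negIntegral μ f : ENNReal) : EReal)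

/-- The admissible pairs of the dual problem: `x · y ≤ f(x) + g(y)` for all `(x, y)`, where `f`
and `g` are measurable (for the completed measures) and have integrals in `(-∞, +∞]`. The values
`-∞` are excluded by the constraint, because `⊤ + ⊥ = ⊥` in `EReal`. The pairs left out by the
conditions on the negative parts are those for which `∫ f dμ + ∫ g dν` has no meaning. -/
structure IsDualAdmissible {n : ℕ} (μ ν : Measure (Rn n)) (f g : Rn n → EReal) : Prop where
  aemeasurable_left : AEMeasurable f μ
  aemeasurable_right : AEMeasurable g ν
  neg_left : negIntegral μ f < ⊤
  neg_right : negIntegral ν g < ⊤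
  inner_le : ∀ x y : Rn n, ((inner ℝ x y : ℝ) : EReal) ≤ f x + g y

/-- The pair `(f, g)` minimizes `∫ f dμ + ∫ g dν` among all admissible pairs. -/
def IsDualMinimizer {n : ℕ} (μ ν : Measure (Rn n)) (f g : Rn n → EReal) : Prop :=
  IsDualAdmissible μ ν f g ∧
    ∀ f' g' : Rn n → EReal, IsDualAdmissible μ ν f' g' →
      extIntegral μ f + extIntegral ν g ≤ extIntegral μ f' + extIntegral ν g'

end ConvexTransport

end

/-! The inequality `μ A ≤ ν (∂ψ A)` is Hall's marriage condition for the relation `Graph ∂ψ`, which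
is closed because `ψ` is lower semicontinuous. Strassen's theorem (`exists_coupling_of_measure_le`)
then gives a coupling `π` concentrated on the graph. It comes from the finite weighted Hall theorem:
quantise both spaces, solve the finite problem, and pass to a weak limit as the cells shrink.

On the graph, Fenchel–Young is an equality, so `∫ ψ dμ + ∫ ψ* dν = ∫ x·y dπ`
(`isDualAdmissible_of_ae_mem_subdiffGraph`). Weak duality (`IsDualAdmissible.integral_inner_le`)
bounds `∫ x·y dρ` by the dual value of any admissible pair, for every coupling `ρ`. Equality for `π`
and `(ψ, ψ*)` makes `π` maximise the correlation and `(ψ, ψ*)` minimise the dual. Since `|x - y|² =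
|x|² + |y|² - 2 x·y` and the marginals are fixed, maximal correlation means minimal quadratic cost.
-/

namespace ConvexTransport

/-! ### Finite transport along a relation. -/

section Hall

open scoped Classical in
/-- **Hall's theorem with weights.** -/
theorem exists_matrix_of_hall {α β : Type*} [Fintype α] [Fintype β] {a : α → ℝ} {b : β → ℝ}
    (hb : ∀ j, 0 ≤ b j) (hab : ∑ i, a i = ∑ j, b j) (r : α → β → Prop)
    (h : ∀ s : Finset α, ∑ i ∈ s, a i ≤ ∑ j with ∃ i ∈ s, r i j, b j) :
    ∃ m : α → β → ℝ, (∀ i j, 0 ≤ m i j) ∧ (∀ i j, ¬ r i j → m i j = 0) ∧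
      (∀ i, ∑ j, m i j = a i) ∧ ∀ j, ∑ i, m i j = b j := by
  -- Hall's condition for all rows, with equal total masses, leaves no mass on isolated columns;
  -- without this `S` below could be empty.
  have hiso : ∀ j, (¬ ∃ i, r i j) → b j = 0 := by
    intro j hj
    have h1 := h Finset.univ
    have h2 := Finset.sum_filter_add_sum_filter_not Finset.univ (fun j => ∃ i, r i j) b
    simp only [Finset.mem_univ, true_and] at h1
    have h3 : ∑ j with ¬ ∃ i, r i j, b j = 0 :=
      le_antisymm (by linarith) (Finset.sum_nonneg fun j _ => hb j)
    exact (Finset.sum_eq_zero_iff_of_nonneg fun j _ => hb j).1 h3 j (by simpa using hj)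
  let S : Set (α → β → ℝ) := {m | (∀ i j, 0 ≤ m i j) ∧ (∀ i j, ¬ r i j → m i j = 0) ∧
    ∀ j, ∑ i, m i j = b j}
  have hSc : IsCompact S := by
    refine (isCompact_Icc (a := (0 : α → β → ℝ)) (b := fun _ j => b j)).of_isClosed_subset ?_ ?_
    · simp only [S, Set.ofPred_and, Set.ofPred_forall]
      refine IsClosed.inter ?_ (IsClosed.inter ?_ ?_)
      · exact isClosed_iInter fun i => isClosed_iInter fun j =>
          isClosed_le continuous_const (by fun_prop)
      · exact isClosed_iInter fun i => isClosed_iInter fun j => isClosed_iInter fun _ =>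
          isClosed_eq (by fun_prop) continuous_const
      · exact isClosed_iInter fun j => isClosed_eq (by fun_prop) continuous_const
    · rintro m ⟨h0, -, h2⟩
      refine ⟨fun i j => h0 i j, fun i j => ?_⟩
      change m i j ≤ b j
      rw [← h2 j]
      exact Finset.single_le_sum (f := fun i => m i j) (fun i _ => h0 i j) (Finset.mem_univ i)
  have hSn : S.Nonempty := by
    have hex : ∀ j, ∃ c : α → ℝ, (∀ i, 0 ≤ c i) ∧ (∀ i, ¬ r i j → c i = 0) ∧ ∑ i, c i = b j := by
      intro j
      by_cases hj : ∃ i, r i j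
      · obtain ⟨i, hi⟩ := hj
        refine ⟨Pi.single i (b j), fun k => ?_, fun k hk => ?_, by simp⟩
        · by_cases hki : k = i
          · subst hki; simpa using hb j
          · simp [hki]
        · have : k ≠ i := fun e => hk (e ▸ hi)
          simp [this]
      · exact ⟨0, by simp, by simp, by simp [hiso j hj]⟩
    choose c hc0 hc1 hc2 using hex
    exact ⟨fun i j => c j i, fun i j => hc0 j i, fun i j => hc1 j i, hc2⟩
  -- Columns are already correct in `S`; minimising the squared row defects will force the rows to
  -- be correct too.
  obtain ⟨m, hmS, hmin⟩ := hSc.exists_isMinOn hSn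
    (f := fun m : α → β → ℝ => ∑ i, (∑ j, m i j - a i) ^ 2) (by fun_prop)
  obtain ⟨hm0, hmr, hmb⟩ := hmS
  set e : α → ℝ := fun i => ∑ j, m i j - a i with he
  -- Otherwise moving mass within column `j` from row `i` to row `i'` would lower the sum of
  -- squares.
  have key : ∀ i i' j, 0 < m i j → r i' j → e i ≤ e i' := by
    intro i i' j hij hr
    by_contra! hlt
    have hne : i ≠ i' := fun h => by rw [h] at hlt; exact lt_irrefl _ hlt
    -- The first bound keeps the entry nonnegative; the second makes the change `2t(e i' - e i) +
    -- 2t²` negative.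
    set t := min (m i j) ((e i - e i') / 2) with ht
    have ht0 : 0 < t := lt_min hij (by linarith)
    have ht1 : t ≤ m i j := min_le_left _ _
    have ht2 : t ≤ (e i - e i') / 2 := min_le_right _ _
    let d : α → ℝ := fun k => (if k = i' then 1 else 0) - (if k = i then 1 else 0)
    let m' : α → β → ℝ := fun k l => m k l + if l = j then t * d k else 0
    have hdsum : ∑ k, d k = 0 := by simp [d]
    have hm' : m' ∈ S := by
      refine ⟨fun k l => ?_, fun k l hkl => ?_, fun l => ?_⟩
      · by_cases hl : l = j
        · subst hl
          by_cases hk : k = i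
          · subst hk; simp [m', d, hne]; linarith
          · have := hm0 k l
            simp only [m', d, if_true, hk, if_false, sub_zero]
            split_ifs <;> nlinarith
        · simpa [m', hl] using hm0 k l
      · by_cases hl : l = j
        · subst hl
          have h1 : k ≠ i' := fun h => hkl (h ▸ hr)
          have h2 : k ≠ i := fun h => by rw [← h, hmr k l hkl] at hij; exact lt_irrefl _ hij
          simp [m', d, h1, h2, hmr k l hkl]
        · simpa [m', hl] using hmr k l hkl
      · simp only [m', Finset.sum_add_distrib, hmb]
        by_cases hl : l = j
        · simp [hl, ← Finset.mul_sum, hdsum]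
        · simp [hl]
    have hle : ∑ k, e k ^ 2 ≤ ∑ k, (e k + t * d k) ^ 2 := by
      have h1 : ∑ k, (∑ l, m k l - a k) ^ 2 ≤ ∑ k, (∑ l, m' k l - a k) ^ 2 := hmin hm'
      convert h1 using 3 with k
      simp only [m', he, Finset.sum_add_distrib, Finset.sum_ite_eq', Finset.mem_univ, if_true]
      ring
    have hexp : ∑ k, (e k + t * d k) ^ 2 = ∑ k, e k ^ 2 + 2 * t * (e i' - e i) + 2 * t ^ 2 := by
      have h1 : ∑ k, e k * d k = e i' - e i := by
        simp [d, mul_sub, Finset.sum_sub_distrib]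
      have h2 : ∑ k, d k ^ 2 = 2 := by
        have : ∀ k, d k ^ 2 = (if k = i' then 1 else 0) + (if k = i then 1 else 0) := by
          intro k
          simp only [d]
          split_ifs with h1 h2
          · exact absurd (h2.symm.trans h1) hne
          all_goals norm_num
        simp only [this, Finset.sum_add_distrib, Finset.sum_ite_eq', Finset.mem_univ, if_true]
        norm_num
      have h3 : ∀ k, (e k + t * d k) ^ 2 = e k ^ 2 + 2 * t * (e k * d k) + t ^ 2 * d k ^ 2 :=
        fun k => by ring
      simp only [h3, Finset.sum_add_distrib, ← Finset.mul_sum, h1, h2]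
      ring
    nlinarith
  have hnn : ∀ i, 0 ≤ e i := by
    by_contra! hneg
    obtain ⟨i₁, hi₁⟩ := hneg
    obtain ⟨i₀, -, hi₀⟩ := Finset.exists_min_image Finset.univ e ⟨i₁, Finset.mem_univ _⟩
    have hneg : e i₀ < 0 := (hi₀ i₁ (Finset.mem_univ _)).trans_lt hi₁
    set R : Finset α := Finset.univ.filter fun i => e i = e i₀ with hR
    -- By `key`, a column related to a row of minimal defect takes mass only from such rows. So the
    -- neighbours of `R` carry at most the row mass of `R`, which is less than `∑ i ∈ R, a i`,
    -- against Hall.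
    have hcol : ∀ j ∈ Finset.univ.filter (fun j => ∃ i ∈ R, r i j), b j = ∑ i ∈ R, m i j := by
      intro j hj
      obtain ⟨i', hi', hr⟩ := (Finset.mem_filter.1 hj).2
      rw [← hmb j]
      refine (Finset.sum_subset (Finset.subset_univ R) fun i _ hi => ?_).symm
      by_contra hne
      have h1 := key i i' j (lt_of_le_of_ne (hm0 i j) (Ne.symm hne)) hr
      rw [(Finset.mem_filter.1 hi').2] at h1
      exact hi (Finset.mem_filter.2 ⟨Finset.mem_univ _, h1.antisymm (hi₀ i (Finset.mem_univ _))⟩)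
    have h1 := h R
    rw [Finset.sum_congr rfl hcol, Finset.sum_comm] at h1
    have h2 : ∑ i ∈ R, ∑ j with ∃ i ∈ R, r i j, m i j ≤ ∑ i ∈ R, ∑ j, m i j :=
      Finset.sum_le_sum fun i _ => Finset.sum_le_sum_of_subset_of_nonneg (Finset.filter_subset _ _)
        fun j _ _ => hm0 i j
    have h3 : ∑ i ∈ R, ∑ j, m i j < ∑ i ∈ R, a i := by
      refine Finset.sum_lt_sum_of_nonempty ⟨i₀, by simp [hR]⟩ fun i hi => ?_
      have : e i < 0 := by rw [(Finset.mem_filter.1 hi).2]; exact hneg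
      simp only [he] at this
      linarith
    linarith
  have hsum : ∑ i, e i = 0 := by
    simp only [he, Finset.sum_sub_distrib]
    rw [Finset.sum_comm, Finset.sum_congr rfl fun j _ => hmb j, hab, sub_self]
  refine ⟨m, hm0, hmr, fun i => ?_, hmb⟩
  have := (Finset.sum_eq_zero_iff_of_nonneg fun i _ => hnn i).1 hsum i (Finset.mem_univ i)
  simp only [he] at this
  linarith

end Hall

/-! ### From finite quantisations to couplings carried by a closed relation. -/

section Strassen

open Filter Topology ProbabilityTheory

/-- Two measures whose quantisations by `p` and `q` satisfy Hall's condition for the relation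
induced by `Γ` have a coupling concentrated on the cells that meet `Γ`. -/
theorem exists_coupling_of_finite {X Y α β : Type*} [MeasurableSpace X] [MeasurableSpace Y]
    [Finite α] [Finite β]
    [MeasurableSpace α] [MeasurableSpace β] [MeasurableSingletonClass α]
    [MeasurableSingletonClass β]
    (μ : Measure X) (ν : Measure Y) [IsProbabilityMeasure μ] [IsProbabilityMeasure ν]
    (Γ : Set (X × Y))
    (h : ∀ A : Set X, MeasurableSet A → μ A ≤ ν {y | ∃ x ∈ A, (x, y) ∈ Γ})
    {p : X → α} {q : Y → β} (hp : Measurable p) (hq : Measurable q) :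
    ∃ π : Measure (X × Y), π.fst = μ ∧ π.snd = ν ∧
      ∀ᵐ z ∂π, ∃ w ∈ Γ, p w.1 = p z.1 ∧ q w.2 = q z.2 := by
  classical
  have := Fintype.ofFinite α
  have := Fintype.ofFinite β
  let r : α → β → Prop := fun i j => ∃ w ∈ Γ, p w.1 = i ∧ q w.2 = j
  have hpi : ∀ s : Finset α, ∑ i ∈ s, μ.real (p ⁻¹' {i}) = μ.real (p ⁻¹' s) := fun s =>
    sum_measureReal_preimage_singleton s fun i _ => hp (measurableSet_singleton i)
  have hqj : ∀ s : Finset β, ∑ j ∈ s, ν.real (q ⁻¹' {j}) = ν.real (q ⁻¹' s) := fun s =>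
    sum_measureReal_preimage_singleton s fun i _ => hq (measurableSet_singleton i)
  obtain ⟨m, hm0, hmr, hma, hmb⟩ := exists_matrix_of_hall (a := fun i => μ.real (p ⁻¹' {i}))
    (b := fun j => ν.real (q ⁻¹' {j})) (fun j => measureReal_nonneg)
    (by simp [hpi, hqj]) r (by
      intro s
      rw [hpi, hqj]
      refine ENNReal.toReal_mono (measure_ne_top _ _)
        ((h _ (hp s.measurableSet)).trans (measure_mono ?_))
      rintro y ⟨x, hx, hxy⟩
      simp only [Set.mem_preimage, Finset.coe_filter, Set.mem_ofPred_eq, Finset.mem_univ, true_and]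
      exact ⟨p x, hx, (x, y), hxy, rfl, rfl⟩)
  -- Conditioning on a null cell gives the zero measure, so such cells must carry no weight.
  have hmμ : ∀ i j, μ (p ⁻¹' {i}) = 0 → m i j = 0 := by
    intro i j h0
    have h1 : ∑ j, m i j = 0 := by rw [hma i, measureReal_def, h0]; rfl
    exact (Finset.sum_eq_zero_iff_of_nonneg fun j _ => hm0 i j).1 h1 j (Finset.mem_univ j)
  have hmν : ∀ i j, ν (q ⁻¹' {j}) = 0 → m i j = 0 := by
    intro i j h0
    have h1 : ∑ i, m i j = 0 := by rw [hmb j, measureReal_def, h0]; rfl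
    exact (Finset.sum_eq_zero_iff_of_nonneg fun i _ => hm0 i j).1 h1 i (Finset.mem_univ i)
  let π : Measure (X × Y) := ∑ i, ∑ j, ENNReal.ofReal (m i j) • (μ[|p ← i]).prod (ν[|q ← j])
  have hsma : ∀ i, ∑ j, ENNReal.ofReal (m i j) = μ (p ⁻¹' {i}) := fun i => by
    rw [← ENNReal.ofReal_sum_of_nonneg fun j _ => hm0 i j, hma, ofReal_measureReal]
  have hsmb : ∀ j, ∑ i, ENNReal.ofReal (m i j) = ν (q ⁻¹' {j}) := fun j => by
    rw [← ENNReal.ofReal_sum_of_nonneg fun i _ => hm0 i j, hmb, ofReal_measureReal]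
  refine ⟨π, ?_, ?_, ?_⟩
  · rw [← sum_meas_smul_cond_fiber hp μ]
    ext A hA
    simp only [π, Measure.fst_apply hA, Measure.coe_finsetSum, Measure.coe_smul,
      Finset.sum_apply, Pi.smul_apply, smul_eq_mul]
    refine Finset.sum_congr rfl fun i _ => ?_
    rw [← hsma i, Finset.sum_mul]
    refine Finset.sum_congr rfl fun j _ => ?_
    by_cases h0 : ν (q ⁻¹' {j}) = 0
    · simp [hmν i j h0]
    · have := cond_isProbabilityMeasure h0
      rw [← Set.prod_univ, Measure.prod_prod, measure_univ, mul_one]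
  · rw [← sum_meas_smul_cond_fiber hq ν]
    ext A hA
    simp only [π, Measure.snd_apply hA, Measure.coe_finsetSum, Measure.coe_smul,
      Finset.sum_apply, Pi.smul_apply, smul_eq_mul]
    rw [Finset.sum_comm]
    refine Finset.sum_congr rfl fun j _ => ?_
    rw [← hsmb j, Finset.sum_mul]
    refine Finset.sum_congr rfl fun i _ => ?_
    by_cases h0 : μ (p ⁻¹' {i}) = 0
    · simp [hmμ i j h0]
    · have := cond_isProbabilityMeasure h0
      rw [← Set.univ_prod, Measure.prod_prod, measure_univ, one_mul]
  · rw [ae_iff]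
    simp only [π, Measure.coe_finsetSum, Measure.coe_smul,
      Finset.sum_apply, Pi.smul_apply, smul_eq_mul]
    refine Finset.sum_eq_zero fun i _ => Finset.sum_eq_zero fun j _ => ?_
    by_cases hij : r i j
    · obtain ⟨w, hw, rfl, rfl⟩ := hij
      have h1 : ∀ᵐ x ∂(μ[|p ← p w.1]), p x = p w.1 :=
        ae_cond_mem (hp (measurableSet_singleton _))
      have h2 : ∀ᵐ y ∂(ν[|q ← q w.2]), q y = q w.2 :=
        ae_cond_mem (hq (measurableSet_singleton _))
      have h3 : ∀ᵐ z ∂(μ[|p ← p w.1]).prod (ν[|q ← q w.2]),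
          ∃ w ∈ Γ, p w.1 = p z.1 ∧ q w.2 = q z.2 := by
        filter_upwards [Measure.quasiMeasurePreserving_fst.ae h1,
          Measure.quasiMeasurePreserving_snd.ae h2] with z hz1 hz2
        exact ⟨w, hw, hz1.symm, hz2.symm⟩
      rw [ae_iff.1 h3, mul_zero]
    · simp [hmr i j hij]

/-- A compact set has a finite measurable quantisation whose cells meeting it are small. -/
theorem exists_finite_quantisation {X : Type*} [PseudoMetricSpace X] [MeasurableSpace X]
    [OpensMeasurableSpace X] {K : Set X} (hK : IsCompact K) {δ : ℝ} (hδ : 0 < δ) :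
    ∃ (t : Set X) (_ : t.Finite) (p : X → t → Prop), Measurable p ∧
      ∀ x ∈ K, ∀ x', p x' = p x → dist x x' < δ := by
  obtain ⟨t, -, htf, ht⟩ := hK.finite_cover_balls (half_pos hδ)
  -- A cell records exactly which balls of the cover contain the point; a point of `K` lies in one
  -- of them and shares it with its whole cell.
  refine ⟨t, htf, fun x c => x ∈ Metric.ball (c : X) (δ / 2), ?_, fun x hx x' hxx' => ?_⟩
  · exact measurable_pi_iff.2 fun c => measurableSet_setOfPred.1 Metric.isOpen_ball.measurableSet
  · obtain ⟨c, hc, hxc⟩ := Set.mem_iUnion₂.1 (ht hx)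
    have h1 : x' ∈ Metric.ball c (δ / 2) := by
      have := congrFun hxx' ⟨c, hc⟩
      simp only [eq_iff_iff] at this
      exact this.2 hxc
    have h2 : dist x c < δ / 2 := hxc
    have h3 : dist x' c < δ / 2 := h1
    linarith [dist_triangle_right x x' c]

theorem measure_compl_prod_le {X Y : Type*} [MeasurableSpace X] [MeasurableSpace Y]
    {π : Measure (X × Y)} {K : Set X} {L : Set Y} (hK : MeasurableSet K) (hL : MeasurableSet L) :
    π (K ×ˢ L)ᶜ ≤ π.fst Kᶜ + π.snd Lᶜ := by
  rw [Measure.fst_apply hK.compl, Measure.snd_apply hL.compl, Set.compl_prod_eq_union,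
    Set.prod_univ, Set.univ_prod]
  exact measure_union_le _ _

section

variable {X Y : Type*} [MetricSpace X] [MetricSpace Y] [MeasurableSpace X] [MeasurableSpace Y]
  [BorelSpace X] [BorelSpace Y] [CompleteSpace X] [CompleteSpace Y]
  [SecondCountableTopology X] [SecondCountableTopology Y]
  (μ : Measure X) (ν : Measure Y) [IsProbabilityMeasure μ] [IsProbabilityMeasure ν]

/-- The couplings of two probability measures on Polish spaces are sequentially precompact. -/
theorem exists_subseq_tendsto_coupling (π : ℕ → ProbabilityMeasure (X × Y))
    (h₁ : ∀ k, (π k : Measure (X × Y)).fst = μ) (h₂ : ∀ k, (π k : Measure (X × Y)).snd = ν) :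
    ∃ (ρ : ProbabilityMeasure (X × Y)) (φ : ℕ → ℕ), StrictMono φ ∧
      Tendsto (π ∘ φ) atTop (𝓝 ρ) ∧ (ρ : Measure (X × Y)).fst = μ ∧
      (ρ : Measure (X × Y)).snd = ν := by
  have ht : IsTightMeasureSet
      {((ρ : ProbabilityMeasure (X × Y)) : Measure (X × Y)) | ρ ∈ Set.range π} := by
    rw [isTightMeasureSet_iff_exists_isCompact_measure_compl_le]
    intro ε hε
    obtain ⟨K, hK, hKε⟩ := isTightMeasureSet_iff_exists_isCompact_measure_compl_le.1
      (isTightMeasureSet_singleton (μ := μ)) (ε / 2) (ENNReal.half_pos hε.ne')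
    obtain ⟨L, hL, hLε⟩ := isTightMeasureSet_iff_exists_isCompact_measure_compl_le.1
      (isTightMeasureSet_singleton (μ := ν)) (ε / 2) (ENNReal.half_pos hε.ne')
    refine ⟨K ×ˢ L, hK.prod hL, ?_⟩
    rintro _ ⟨_, ⟨k, rfl⟩, rfl⟩
    refine (measure_compl_prod_le hK.measurableSet hL.measurableSet).trans ?_
    rw [h₁, h₂, ← ENNReal.add_halves ε]
    exact add_le_add (hKε _ rfl) (hLε _ rfl)
  obtain ⟨ρ, -, φ, hφ, hlim⟩ := (isCompact_closure_of_isTightMeasureSet ht).tendsto_subseq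
    (x := π) fun k => subset_closure ⟨k, rfl⟩
  refine ⟨ρ, φ, hφ, hlim, ?_, ?_⟩
  · let μ' : ProbabilityMeasure _ := ⟨μ, inferInstance⟩
    -- The marginals form a constant sequence, and projection is weakly continuous.
    have h : Tendsto (fun _ : ℕ => μ') atTop
        (𝓝 (ρ.map continuous_fst.measurable.aemeasurable)) := by
      refine (ProbabilityMeasure.tendsto_map_of_tendsto_of_continuous _ _ hlim
        continuous_fst).congr fun k => ?_
      exact Subtype.ext (h₁ (φ k))
    have h' := tendsto_nhds_unique h tendsto_const_nhds
    exact congrArg Subtype.val h'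
  · let ν' : ProbabilityMeasure _ := ⟨ν, inferInstance⟩
    have h : Tendsto (fun _ : ℕ => ν') atTop
        (𝓝 (ρ.map continuous_snd.measurable.aemeasurable)) := by
      refine (ProbabilityMeasure.tendsto_map_of_tendsto_of_continuous _ _ hlim
        continuous_snd).congr fun k => ?_
      exact Subtype.ext (h₂ (φ k))
    have h' := tendsto_nhds_unique h tendsto_const_nhds
    exact congrArg Subtype.val h'

/-- **Strassen's theorem**: a closed relation satisfying Hall's condition carries a coupling. -/
theorem exists_coupling_of_measure_le {Γ : Set (X × Y)} (hΓ : IsClosed Γ)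
    (h : ∀ A : Set X, MeasurableSet A → μ A ≤ ν {y | ∃ x ∈ A, (x, y) ∈ Γ}) :
    ∃ π : Measure (X × Y), π.fst = μ ∧ π.snd = ν ∧ π Γᶜ = 0 := by
  have happrox : ∀ δ : ℝ, 0 < δ → ∃ π : Measure (X × Y), π.fst = μ ∧ π.snd = ν ∧
      π (Metric.cthickening δ Γ)ᶜ ≤ ENNReal.ofReal δ := by
    intro δ hδ
    have hδ' : 0 < ENNReal.ofReal δ / 2 := ENNReal.half_pos (ENNReal.ofReal_pos.2 hδ).ne'
    obtain ⟨K, hK, hKδ⟩ := isTightMeasureSet_iff_exists_isCompact_measure_compl_le.1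
      (isTightMeasureSet_singleton (μ := μ)) _ hδ'
    obtain ⟨L, hL, hLδ⟩ := isTightMeasureSet_iff_exists_isCompact_measure_compl_le.1
      (isTightMeasureSet_singleton (μ := ν)) _ hδ'
    obtain ⟨s, hs, p, hp, hpK⟩ := exists_finite_quantisation hK hδ
    obtain ⟨t, ht, q, hq, hqL⟩ := exists_finite_quantisation hL hδ
    have := hs.to_subtype
    have := ht.to_subtype
    obtain ⟨π, h1, h2, h3⟩ := exists_coupling_of_finite μ ν Γ h hp hq
    refine ⟨π, h1, h2, ?_⟩
    -- On `K ×ˢ L`, almost every point shares its cells with a point of `Γ`, hence lies within `δ`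
    -- of it.
    have h4 : π (Metric.cthickening δ Γ)ᶜ ≤ π (K ×ˢ L)ᶜ := by
      refine measure_mono_ae ?_
      filter_upwards [h3] with z hz hzΓ hzKL
      obtain ⟨w, hw, hw1, hw2⟩ := hz
      refine hzΓ (Metric.mem_cthickening_of_dist_le z w δ Γ hw ?_)
      exact max_le (hpK _ hzKL.1 _ hw1).le (hqL _ hzKL.2 _ hw2).le
    refine h4.trans ((measure_compl_prod_le hK.measurableSet hL.measurableSet).trans ?_)
    rw [h1, h2, ← ENNReal.add_halves (ENNReal.ofReal δ)]
    exact add_le_add (hKδ _ rfl) (hLδ _ rfl)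
  obtain ⟨u, -, hu0, hu⟩ := exists_seq_strictAnti_tendsto (0 : ℝ)
  choose π h1 h2 h3 using fun k => happrox (u k) (hu0 k)
  have hprob : ∀ k, IsProbabilityMeasure (π k) := fun k =>
    ⟨by rw [← Measure.fst_univ, h1, measure_univ]⟩
  obtain ⟨ρ, φ, hφ, hlim, hρ1, hρ2⟩ := exists_subseq_tendsto_coupling μ ν
    (fun k => ⟨π k, hprob k⟩) h1 h2
  refine ⟨ρ, hρ1, hρ2, ?_⟩
  have huφ : Tendsto (u ∘ φ) atTop (𝓝 0) := hu.comp hφ.tendsto_atTop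
  -- Portmanteau on the open complement of a fixed thickening, which eventually contains the
  -- thickenings of radius `u (φ k)`.
  have hnull : ∀ δ : ℝ, 0 < δ → (ρ : Measure (X × Y)) (Metric.cthickening δ Γ)ᶜ = 0 := by
    intro δ hδ
    have h4 := ProbabilityMeasure.le_liminf_measure_open_of_tendsto hlim
      (G := (Metric.cthickening δ Γ)ᶜ) Metric.isClosed_cthickening.isOpen_compl
    have h5 : Tendsto (fun k => π (φ k) (Metric.cthickening δ Γ)ᶜ) atTop (𝓝 0) := by
      refine tendsto_of_tendsto_of_tendsto_of_le_of_le' tendsto_const_nhds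
        (h := fun k => ENNReal.ofReal (u (φ k))) ?_ (Eventually.of_forall fun _ => zero_le) ?_
      · simpa using ENNReal.tendsto_ofReal huφ
      · filter_upwards [huφ.eventually_le_const hδ] with k hk
        exact (measure_mono (Set.compl_subset_compl.2 (Metric.cthickening_mono hk Γ))).trans
          (h3 (φ k))
    exact le_antisymm (h4.trans h5.liminf_eq.le) (zero_le)
  have hcov : Γᶜ ⊆ ⋃ k, (Metric.cthickening (u k) Γ)ᶜ := by
    intro z hz
    by_contra hcon
    simp only [Set.mem_iUnion, Set.mem_compl_iff, not_exists, not_not] at hcon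
    refine hz ?_
    rw [← hΓ.closure_eq, Metric.closure_eq_iInter_cthickening]
    refine Set.mem_iInter₂.2 fun ε hε => ?_
    obtain ⟨k, hk⟩ := (hu.eventually_le_const hε).exists
    exact Metric.cthickening_mono hk Γ (hcon k)
  exact measure_mono_null hcov (measure_iUnion_null fun k => hnull _ (hu0 k))

end

end Strassen

/-! ### Subdifferentials and Fenchel–Young. -/

section Subdifferential

variable {n : ℕ} {ψ : Rn n → EReal}

/-- Each test point `y` imposes a sublevel condition on a function of `(x, z)` that is lower
semicontinuous: `ψ x` plus a finite continuous term. -/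
theorem isClosed_subdiffGraph (hψ : IsProperLscConvex ψ) : IsClosed (subdiffGraph ψ) := by
  have h : subdiffGraph ψ = ⋂ y, (fun p : Rn n × Rn n =>
      ψ p.1 + ((inner ℝ p.2 (y - p.1) : ℝ) : EReal)) ⁻¹' Set.Iic (ψ y) := by
    ext p
    simp [subdiffGraph, subdiff]
  rw [h]
  refine isClosed_iInter fun y => LowerSemicontinuous.isClosed_preimage ?_ _
  refine LowerSemicontinuous.add' (hψ.lsc.comp continuous_fst) ?_ fun p => ?_
  · exact (continuous_coe_real_ereal.comp (by fun_prop)).lowerSemicontinuous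
  · exact EReal.continuousAt_add (Or.inr (EReal.coe_ne_bot _)) (Or.inr (EReal.coe_ne_top _))

theorem subdiffImage_eq (ψ : Rn n → EReal) (A : Set (Rn n)) :
    subdiffImage ψ A = {y | ∃ x ∈ A, (x, y) ∈ subdiffGraph ψ} := by
  ext y
  simp [subdiffImage, subdiffGraph]

theorem ne_top_of_mem_subdiffGraph (hψ : IsProperLscConvex ψ) {x z : Rn n}
    (h : (x, z) ∈ subdiffGraph ψ) : ψ x ≠ ⊤ := by
  obtain ⟨y, hy⟩ := hψ.exists_ne_top
  intro hx
  have h1 : ψ x + ((inner ℝ z (y - x) : ℝ) : EReal) ≤ ψ y := h y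
  rw [hx, EReal.top_add_coe, top_le_iff] at h1
  exact hy h1

theorem legendre_ne_bot (hψ : IsProperLscConvex ψ) (z : Rn n) : legendre ψ z ≠ ⊥ := by
  obtain ⟨y, hy⟩ := hψ.exists_ne_top
  refine ne_bot_of_le_ne_bot ?_ (le_iSup (fun x => ((inner ℝ x z : ℝ) : EReal) - ψ x) y)
  lift ψ y to ℝ using ⟨hy, hψ.ne_bot y⟩ with c
  rw [← EReal.coe_sub]
  exact EReal.coe_ne_bot _

/-- The Fenchel–Young inequality. -/
theorem inner_le_add_legendre (hψ : IsProperLscConvex ψ) (x z : Rn n) :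
    ((inner ℝ x z : ℝ) : EReal) ≤ ψ x + legendre ψ z := by
  by_cases hx : ψ x = ⊤
  · rw [hx, EReal.top_add_of_ne_bot (legendre_ne_bot hψ z)]
    exact le_top
  · have h := le_iSup (fun x => ((inner ℝ x z : ℝ) : EReal) - ψ x) x
    have h' : ((inner ℝ x z : ℝ) : EReal) - ψ x ≤ legendre ψ z := h
    rw [add_comm]
    exact (EReal.sub_le_iff_le_add (Or.inl (hψ.ne_bot x)) (Or.inl hx)).1 h'

/-- Equality in the Fenchel–Young inequality on the graph of the subdifferential. -/
theorem legendre_eq_of_mem_subdiffGraph (hψ : IsProperLscConvex ψ) {x z : Rn n}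
    (h : (x, z) ∈ subdiffGraph ψ) :
    legendre ψ z = ((inner ℝ x z - (ψ x).toReal : ℝ) : EReal) := by
  have hx : ψ x = ((ψ x).toReal : EReal) :=
    (EReal.coe_toReal (ne_top_of_mem_subdiffGraph hψ h) (hψ.ne_bot x)).symm
  refine le_antisymm (iSup_le fun y => ?_) ?_
  · have h1 : ψ x + ((inner ℝ z (y - x) : ℝ) : EReal) ≤ ψ y := h y
    by_cases hy : ψ y = ⊤
    · simp [hy]
    · lift ψ y to ℝ using ⟨hy, hψ.ne_bot y⟩ with c
      rw [hx, ← EReal.coe_add, EReal.coe_le_coe_iff, inner_sub_right] at h1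
      rw [← EReal.coe_sub, EReal.coe_le_coe_iff, real_inner_comm z y, real_inner_comm z x]
      linarith
  · rw [EReal.coe_sub, ← hx]
    exact le_iSup (fun x => ((inner ℝ x z : ℝ) : EReal) - ψ x) x

theorem lowerSemicontinuous_legendre (ψ : Rn n → EReal) : LowerSemicontinuous (legendre ψ) := by
  refine lowerSemicontinuous_iSup fun x => ?_
  induction ψ x with
  | bot => simpa using lowerSemicontinuous_const
  | top => simpa using lowerSemicontinuous_const
  | coe c =>
    simp only [← EReal.coe_sub]
    exact (continuous_coe_real_ereal.comp (by fun_prop)).lowerSemicontinuous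

end Subdifferential

/-! ### Integrals of extended-real functions. -/

section Integral

variable {n : ℕ}

theorem lintegral_toENNReal_lt_top {α : Type*} [MeasurableSpace α] {μ : Measure α}
    {f : α → EReal} {h : α → ℝ} (hh : Integrable h μ) (hf : ∀ᵐ x ∂μ, f x ≤ (h x : EReal)) :
    ∫⁻ x, (f x).toENNReal ∂μ < ⊤ := by
  refine (lintegral_mono_ae ?_).trans_lt hh.lintegral_lt_top
  filter_upwards [hf] with x hx
  simpa using EReal.toENNReal_le_toENNReal hx

theorem negIntegral_lt_top {μ : Measure (Rn n)} {f : Rn n → EReal} {h : Rn n → ℝ}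
    (hh : Integrable h μ) (hf : ∀ᵐ x ∂μ, (h x : EReal) ≤ f x) : negIntegral μ f < ⊤ := by
  refine lintegral_toENNReal_lt_top hh.neg ?_
  filter_upwards [hf] with x hx
  simpa using EReal.neg_le_neg_iff.2 hx

/-- If both parts of `f` have finite integrals, then `f` is integrable and `extIntegral` is its
Bochner integral. -/
theorem extIntegral_eq_integral {μ : Measure (Rn n)} {f : Rn n → EReal} (hf : AEMeasurable f μ)
    (hpos : ∫⁻ x, (f x).toENNReal ∂μ < ⊤) (hneg : negIntegral μ f < ⊤) :
    (∀ᵐ x ∂μ, f x = ((f x).toReal : EReal)) ∧ Integrable (fun x => (f x).toReal) μ ∧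
      extIntegral μ f = ((∫ x, (f x).toReal ∂μ : ℝ) : EReal) := by
  have hm1 : AEMeasurable (fun x => (f x).toENNReal) μ :=
    measurable_ereal_toENNReal.comp_aemeasurable hf
  have hm2 : AEMeasurable (fun x => (-f x).toENNReal) μ :=
    measurable_ereal_toENNReal.comp_aemeasurable hf.neg
  have hfin : ∀ᵐ x ∂μ, f x = ((f x).toReal : EReal) := by
    filter_upwards [ae_lt_top' hm1 hpos.ne, ae_lt_top' hm2 hneg.ne] with x h1 h2
    refine (EReal.coe_toReal ?_ ?_).symm
    · exact EReal.toENNReal_ne_top_iff.1 h1.ne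
    · have := EReal.toENNReal_ne_top_iff.1 h2.ne
      simpa [EReal.neg_eq_top_iff] using this
  have e1 : ∫⁻ x, (f x).toENNReal ∂μ = ∫⁻ x, ENNReal.ofReal (f x).toReal ∂μ := by
    refine lintegral_congr_ae ?_
    filter_upwards [hfin] with x hx
    rw [hx]; simp
  have e2 : negIntegral μ f = ∫⁻ x, ENNReal.ofReal (-(f x).toReal) ∂μ := by
    refine lintegral_congr_ae ?_
    filter_upwards [hfin] with x hx
    rw [hx, ← EReal.coe_neg]; simp
  have hint : Integrable (fun x => (f x).toReal) μ := by
    refine ⟨hf.ereal_toReal.aestronglyMeasurable, ?_⟩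
    have h1 : ∀ x, ‖(f x).toReal‖ₑ
        = ENNReal.ofReal (f x).toReal + ENNReal.ofReal (-(f x).toReal) := by
      intro x
      rw [Real.enorm_eq_ofReal_abs]
      rcases le_total 0 (f x).toReal with h | h
      · rw [abs_of_nonneg h, ENNReal.ofReal_of_nonpos (neg_nonpos.2 h), add_zero]
      · rw [abs_of_nonpos h, ENNReal.ofReal_of_nonpos h, zero_add]
    rw [HasFiniteIntegral, lintegral_congr h1,
      lintegral_add_left' hf.ereal_toReal.ennreal_ofReal, ← e1, ← e2]
    exact ENNReal.add_lt_top.2 ⟨hpos, hneg⟩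
  refine ⟨hfin, hint, ?_⟩
  rw [integral_eq_lintegral_pos_part_sub_lintegral_neg_part hint, ← e1, ← e2, EReal.coe_sub,
    EReal.coe_ennreal_toReal hpos.ne, EReal.coe_ennreal_toReal hneg.ne]
  rfl

end Integral

/-! ### Correlation, cost and duality. -/

section Duality

variable {n : ℕ} {μ ν : Measure (Rn n)} {π : Measure (Rn n × Rn n)}

theorem integrable_norm_sq (h : ∫⁻ x, ‖x‖ₑ ^ 2 ∂μ < ⊤) : Integrable (fun x => ‖x‖ ^ 2) μ := by
  refine ⟨by fun_prop, ?_⟩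
  simpa [HasFiniteIntegral, enorm_pow] using h

theorem integrable_id_of_norm_sq [IsFiniteMeasure μ] (h : Integrable (fun x => ‖x‖ ^ 2) μ) :
    Integrable (fun x => x) μ := by
  refine (h.add (integrable_const (1 : ℝ))).mono' (by fun_prop) (ae_of_all _ fun x => ?_)
  simp only [Pi.add_apply]
  nlinarith [sq_nonneg (‖x‖ - 1), sq_nonneg ‖x‖]

theorem integrable_inner_of_norm_sq (h1 : MeasurePreserving Prod.fst π μ)
    (h2 : MeasurePreserving Prod.snd π ν) (hμ : Integrable (fun x => ‖x‖ ^ 2) μ)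
    (hν : Integrable (fun x => ‖x‖ ^ 2) ν) :
    Integrable (fun p => (inner ℝ p.1 p.2 : ℝ)) π := by
  refine ((h1.integrable_comp_of_integrable hμ).add (h2.integrable_comp_of_integrable hν)).mono'
    (by fun_prop) (ae_of_all _ fun p => ?_)
  have h := norm_inner_le_norm (𝕜 := ℝ) p.1 p.2
  simp only [Pi.add_apply, Function.comp_apply]
  nlinarith [sq_nonneg (‖p.1‖ - ‖p.2‖), sq_nonneg ‖p.1‖, sq_nonneg ‖p.2‖]

/-- Only the correlation term depends on the coupling, so comparing costs reduces to comparing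
correlations. -/
theorem quadCost_eq (h1 : MeasurePreserving Prod.fst π μ)
    (h2 : MeasurePreserving Prod.snd π ν) (hμ : Integrable (fun x => ‖x‖ ^ 2) μ)
    (hν : Integrable (fun x => ‖x‖ ^ 2) ν) :
    quadCost π = ENNReal.ofReal
      (∫ x, ‖x‖ ^ 2 ∂μ + ∫ y, ‖y‖ ^ 2 ∂ν - 2 * ∫ p, (inner ℝ p.1 p.2 : ℝ) ∂π) := by
  have i1 := h1.integrable_comp_of_integrable hμ
  have i2 := h2.integrable_comp_of_integrable hν
  have i3 := (integrable_inner_of_norm_sq h1 h2 hμ hν).const_mul 2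
  have e : ∀ p : Rn n × Rn n, ‖p.1 - p.2‖ ^ 2
      = ‖p.1‖ ^ 2 + ‖p.2‖ ^ 2 - 2 * (inner ℝ p.1 p.2 : ℝ) := fun p => by
    rw [norm_sub_sq_real]; ring
  have hint : Integrable (fun p : Rn n × Rn n => ‖p.1 - p.2‖ ^ 2) π := by
    simp only [e]
    exact (i1.add i2).sub i3
  have e1 : ∫ x, ‖x‖ ^ 2 ∂μ = ∫ p, ‖p.1‖ ^ 2 ∂π := by
    rw [← h1.map_eq, integral_map h1.measurable.aemeasurable (by fun_prop)]
  have e2 : ∫ x, ‖x‖ ^ 2 ∂ν = ∫ p, ‖p.2‖ ^ 2 ∂π := by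
    rw [← h2.map_eq, integral_map h2.measurable.aemeasurable (by fun_prop)]
  have e3 : ∫ p, ‖p.1 - p.2‖ ^ 2 ∂π
      = ∫ x, ‖x‖ ^ 2 ∂μ + ∫ y, ‖y‖ ^ 2 ∂ν - 2 * ∫ p, (inner ℝ p.1 p.2 : ℝ) ∂π := by
    rw [integral_congr_ae (ae_of_all _ e), e1, e2, ← integral_const_mul]
    exact (integral_sub (i1.add i2) i3).trans (congrArg (· - _) (integral_add i1 i2))
  rw [← e3, ofReal_integral_eq_lintegral_ofReal hint (ae_of_all _ fun p => sq_nonneg _)]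
  refine lintegral_congr fun p => ?_
  rw [ENNReal.ofReal_pow (norm_nonneg _), ofReal_norm]

/-- Integration of an a.e. real-valued pair of functions against a coupling. -/
theorem extIntegral_add_eq_integral (h1 : MeasurePreserving Prod.fst π μ)
    (h2 : MeasurePreserving Prod.snd π ν) {f g : Rn n → EReal} (hf : AEMeasurable f μ)
    (hg : AEMeasurable g ν) (hf_pos : ∫⁻ x, (f x).toENNReal ∂μ < ⊤) (hf_neg : negIntegral μ f < ⊤)
    (hg_pos : ∫⁻ x, (g x).toENNReal ∂ν < ⊤) (hg_neg : negIntegral ν g < ⊤) :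
    (∀ᵐ p ∂π, f p.1 + g p.2 = (((f p.1).toReal + (g p.2).toReal : ℝ) : EReal)) ∧
      Integrable (fun p => (f p.1).toReal + (g p.2).toReal) π ∧
      extIntegral μ f + extIntegral ν g
        = ((∫ p, ((f p.1).toReal + (g p.2).toReal) ∂π : ℝ) : EReal) := by
  obtain ⟨a1, a2, a3⟩ := extIntegral_eq_integral hf hf_pos hf_neg
  obtain ⟨b1, b2, b3⟩ := extIntegral_eq_integral hg hg_pos hg_neg
  have i1 := h1.integrable_comp_of_integrable a2
  have i2 := h2.integrable_comp_of_integrable b2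
  refine ⟨?_, i1.add i2, ?_⟩
  · filter_upwards [h1.quasiMeasurePreserving.ae a1, h2.quasiMeasurePreserving.ae b1] with p hp hq
    rw [EReal.coe_add, ← hp, ← hq]
  · have e1 : ∫ x, (f x).toReal ∂μ = ∫ p, (f p.1).toReal ∂π := by
      rw [← h1.map_eq] at a2 ⊢
      exact integral_map h1.measurable.aemeasurable a2.aestronglyMeasurable
    have e2 : ∫ x, (g x).toReal ∂ν = ∫ p, (g p.2).toReal ∂π := by
      rw [← h2.map_eq] at b2 ⊢
      exact integral_map h2.measurable.aemeasurable b2.aestronglyMeasurable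
    rw [a3, b3, ← EReal.coe_add, e1, e2]
    exact congrArg _ (integral_add i1 i2).symm

theorem extIntegral_ne_bot {f : Rn n → EReal} (h : negIntegral μ f < ⊤) :
    extIntegral μ f ≠ ⊥ := by
  unfold extIntegral
  lift negIntegral μ f to NNReal using h.ne with c
  intro hbot
  rw [sub_eq_add_neg, EReal.add_eq_bot_iff] at hbot
  rcases hbot with hbot | hbot
  · exact EReal.coe_ennreal_ne_bot _ hbot
  · rw [EReal.neg_eq_bot_iff] at hbot
    exact ENNReal.coe_ne_top (EReal.coe_ennreal_eq_top_iff.1 hbot)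

theorem extIntegral_eq_top {f : Rn n → EReal} (h : negIntegral μ f < ⊤)
    (h' : ∫⁻ x, (f x).toENNReal ∂μ = ⊤) : extIntegral μ f = ⊤ := by
  unfold extIntegral
  lift negIntegral μ f to NNReal using h.ne with c
  rw [h', EReal.coe_ennreal_top]
  exact EReal.top_sub_coe (c : ℝ)

/-- Weak duality. -/
theorem IsDualAdmissible.integral_inner_le {f g : Rn n → EReal} (h : IsDualAdmissible μ ν f g)
    (h1 : MeasurePreserving Prod.fst π μ) (h2 : MeasurePreserving Prod.snd π ν)
    (hint : Integrable (fun p => (inner ℝ p.1 p.2 : ℝ)) π) :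
    ((∫ p, (inner ℝ p.1 p.2 : ℝ) ∂π : ℝ) : EReal) ≤ extIntegral μ f + extIntegral ν g := by
  -- An infinite positive part makes the right side `⊤`, the other integral not being `⊥`; otherwise
  -- everything is a Bochner integral.
  rcases eq_top_or_lt_top (∫⁻ x, (f x).toENNReal ∂μ) with hf | hf
  · rw [extIntegral_eq_top h.neg_left hf, EReal.top_add_of_ne_bot (extIntegral_ne_bot h.neg_right)]
    exact le_top
  rcases eq_top_or_lt_top (∫⁻ x, (g x).toENNReal ∂ν) with hg | hg
  · rw [extIntegral_eq_top h.neg_right hg, EReal.add_top_of_ne_bot (extIntegral_ne_bot h.neg_left)]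
    exact le_top
  obtain ⟨e1, e2, e3⟩ := extIntegral_add_eq_integral h1 h2 h.aemeasurable_left
    h.aemeasurable_right hf h.neg_left hg h.neg_right
  rw [e3, EReal.coe_le_coe_iff]
  refine integral_mono_ae hint e2 ?_
  filter_upwards [e1] with p hp
  have := h.inner_le p.1 p.2
  rwa [hp, EReal.coe_le_coe_iff] at this

variable {ψ : Rn n → EReal}

/-- A coupling carried by the graph of `∂ψ` makes `(ψ, ψ*)` admissible, without duality gap. -/
theorem isDualAdmissible_of_ae_mem_subdiffGraph [IsProbabilityMeasure π]
    (hψ : IsProperLscConvex ψ) (h1 : MeasurePreserving Prod.fst π μ)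
    (h2 : MeasurePreserving Prod.snd π ν) (hμ : Integrable (fun x => x) μ)
    (hν : Integrable (fun x => x) ν)
    (hint : Integrable (fun p => (inner ℝ p.1 p.2 : ℝ)) π) (hπ : ∀ᵐ p ∂π, p ∈ subdiffGraph ψ) :
    IsDualAdmissible μ ν ψ (legendre ψ) ∧ extIntegral μ ψ + extIntegral ν (legendre ψ)
      = ((∫ p, (inner ℝ p.1 p.2 : ℝ) ∂π : ℝ) : EReal) := by
  have : IsProbabilityMeasure μ := h1.map_eq ▸
    Measure.isProbabilityMeasure_map h1.measurable.aemeasurable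
  have : IsProbabilityMeasure ν := h2.map_eq ▸
    Measure.isProbabilityMeasure_map h2.measurable.aemeasurable
  -- One point of the graph yields affine minorants of both `ψ` and `ψ*`, integrable by the first
  -- moments.
  obtain ⟨⟨x₀, z₀⟩, h0⟩ := hπ.exists
  have hm1 : AEMeasurable ψ μ := hψ.lsc.measurable.aemeasurable
  have hm2 : AEMeasurable (legendre ψ) ν :=
    (lowerSemicontinuous_legendre ψ).measurable.aemeasurable
  have hreal : ∀ {x z : Rn n}, (x, z) ∈ subdiffGraph ψ → ψ x = ((ψ x).toReal : EReal) :=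
    fun h => (EReal.coe_toReal (ne_top_of_mem_subdiffGraph hψ h) (hψ.ne_bot _)).symm
  have hlow1 : ∀ x, (((ψ x₀).toReal + inner ℝ z₀ (x - x₀) : ℝ) : EReal) ≤ ψ x := fun x => by
    rw [EReal.coe_add, ← hreal h0]
    exact h0 x
  have hlow2 : ∀ z, ((inner ℝ x₀ z - (ψ x₀).toReal : ℝ) : EReal) ≤ legendre ψ z := fun z => by
    rw [EReal.coe_sub, ← hreal h0]
    exact le_iSup (fun x => ((inner ℝ x z : ℝ) : EReal) - ψ x) x₀
  have hi1 : Integrable (fun x => (ψ x₀).toReal + (inner ℝ z₀ (x - x₀) : ℝ)) μ :=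
    (integrable_const _).add ((hμ.sub (integrable_const x₀)).const_inner z₀)
  have hi2 : Integrable (fun z => (inner ℝ x₀ z : ℝ) - (ψ x₀).toReal) ν :=
    (hν.const_inner x₀).sub (integrable_const _)
  -- On the graph `ψ x = x·z - ψ* z`, so the affine minorant of `ψ*` bounds `ψ` above by a
  -- `π`-integrable function. The bound for `ψ*` is symmetric.
  have hp1 : ∫⁻ x, (ψ x).toENNReal ∂μ < ⊤ := by
    rw [← h1.lintegral_comp hψ.lsc.measurable.ereal_toENNReal]
    refine lintegral_toENNReal_lt_top (hint.sub (h2.integrable_comp_of_integrable hi2)) ?_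
    filter_upwards [hπ] with p hp
    have h3 := hlow2 p.2
    rw [legendre_eq_of_mem_subdiffGraph hψ hp, EReal.coe_le_coe_iff] at h3
    rw [hreal hp, EReal.coe_le_coe_iff]
    simp only [Pi.sub_apply, Function.comp_apply]
    linarith
  have hp2 : ∫⁻ x, (legendre ψ x).toENNReal ∂ν < ⊤ := by
    rw [← h2.lintegral_comp (lowerSemicontinuous_legendre ψ).measurable.ereal_toENNReal]
    refine lintegral_toENNReal_lt_top (hint.sub (h1.integrable_comp_of_integrable hi1)) ?_
    filter_upwards [hπ] with p hp
    have h3 := hlow1 p.1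
    rw [hreal hp, EReal.coe_le_coe_iff] at h3
    rw [legendre_eq_of_mem_subdiffGraph hψ hp, EReal.coe_le_coe_iff]
    simp only [Pi.sub_apply, Function.comp_apply]
    linarith
  have hn1 : negIntegral μ ψ < ⊤ := negIntegral_lt_top hi1 (ae_of_all _ hlow1)
  have hn2 : negIntegral ν (legendre ψ) < ⊤ := negIntegral_lt_top hi2 (ae_of_all _ hlow2)
  refine ⟨⟨hm1, hm2, hn1, hn2, inner_le_add_legendre hψ⟩, ?_⟩
  rw [(extIntegral_add_eq_integral h1 h2 hm1 hm2 hp1 hn1 hp2 hn2).2.2]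
  congr 1
  refine integral_congr_ae ?_
  filter_upwards [hπ] with p hp
  rw [legendre_eq_of_mem_subdiffGraph hψ hp, EReal.toReal_coe]
  ring

end Duality

end ConvexTransport

/-! ### The main theorem. -/

open ConvexTransport

theorem theorem1p1 (n : ℕ) (μ ν : MeasureTheory.Measure (ConvexTransport.Rn n))
    [MeasureTheory.IsProbabilityMeasure μ] [MeasureTheory.IsProbabilityMeasure ν]
    (hmom : (∫⁻ x, ‖x‖ₑ ^ 2 ∂μ) + (∫⁻ y, ‖y‖ₑ ^ 2 ∂ν) < ⊤)
    (ψ : ConvexTransport.Rn n → EReal) (hψ : ConvexTransport.IsProperLscConvex ψ)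
    (h₁ : ∀ A : Set (ConvexTransport.Rn n), MeasurableSet A →
      μ A ≤ ν (ConvexTransport.subdiffImage ψ A))
    (h₂ : ∀ A : Set (ConvexTransport.Rn n), MeasurableSet A →
      ν A ≤ μ (ConvexTransport.subdiffImage (ConvexTransport.legendre ψ) A)) :
    (∃ π : MeasureTheory.Measure (ConvexTransport.Rn n × ConvexTransport.Rn n),
      ConvexTransport.IsOptimalPlan μ ν π ∧ π.support ⊆ ConvexTransport.subdiffGraph ψ) ∧
    ConvexTransport.IsDualMinimizer μ ν ψ (ConvexTransport.legendre ψ) := by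
  obtain ⟨hmμ, hmν⟩ := ENNReal.add_lt_top.1 hmom
  have hμ := integrable_norm_sq hmμ
  have hν := integrable_norm_sq hmν
  have hΓ := isClosed_subdiffGraph hψ
  obtain ⟨π, hπ1, hπ2, hπ⟩ := exists_coupling_of_measure_le μ ν hΓ fun A hA => by
    rw [← subdiffImage_eq]
    exact h₁ A hA
  have hprob : IsProbabilityMeasure π := ⟨by rw [← Measure.fst_univ, hπ1, measure_univ]⟩
  have p1 : MeasurePreserving Prod.fst π μ := ⟨measurable_fst, hπ1⟩
  have p2 : MeasurePreserving Prod.snd π ν := ⟨measurable_snd, hπ2⟩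
  obtain ⟨hadm, heq⟩ := isDualAdmissible_of_ae_mem_subdiffGraph hψ p1 p2
    (integrable_id_of_norm_sq hμ) (integrable_id_of_norm_sq hν)
    (integrable_inner_of_norm_sq p1 p2 hμ hν) (measure_eq_zero_iff_ae_notMem.1 hπ |>.mono
      fun p hp => not_not.1 hp)
  refine ⟨⟨π, ⟨⟨hprob, hπ1, hπ2⟩, ?_⟩, Measure.support_subset_of_isClosed hΓ
    (mem_ae_iff.2 hπ)⟩, hadm, fun f g hfg => ?_⟩
  · rintro ρ ⟨-, hρ1, hρ2⟩
    have q1 : MeasurePreserving Prod.fst ρ μ := ⟨measurable_fst, hρ1⟩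
    have q2 : MeasurePreserving Prod.snd ρ ν := ⟨measurable_snd, hρ2⟩
    -- With `heq`, weak duality for `(ψ, ψ*)` says that no competitor `ρ` has larger correlation
    -- than `π`.
    have h := hadm.integral_inner_le q1 q2 (integrable_inner_of_norm_sq q1 q2 hμ hν)
    rw [heq, EReal.coe_le_coe_iff] at h
    rw [quadCost_eq p1 p2 hμ hν, quadCost_eq q1 q2 hμ hν]
    exact ENNReal.ofReal_le_ofReal (by linarith)
  · rw [heq]
    exact hfg.integral_inner_le p1 p2 (integrable_inner_of_norm_sq p1 p2 hμ hν)
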